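/- **Proposition (lower semi-continuity of local discrepancies).** Let $\Omega$ be a compact metric space and let $\mathcal M(\Omega)$ be the space of finite signed Radon measures on $\Omega$. Equip $\mathcal M(\Omega)^2$ with the weak-* topology, i.e. the coarsest topology for which $(\rho_0,\rho_1)\mapsto\int_\Omega u_0\,\mathrm d\rho_0+\int_\Omega u_1\,\mathrm d\rho_1$ is continuous for all $u_0,u_1\in C(\Omega)$. Let $c:\mathbb R\times\mathbb R\to[0,\infty]$ satisfy: (a) $c$ is convex, positively 1-homogeneous (that is, $c(tm)=t\,c(m)$ for all $t>0$ and $m\in\mathbb R^2$) and lower semi-continuous, jointly in both arguments; (b) $c(m,m)=0$ for all $m\ge 0$, and $c(m_0,m_1)>0$ if $m_0\ne m_1$; (c) $c(m_0,m_1)=\infty$ whenever $m_0<0$ or $m_1<0$. Let $D:\mathcal M(\Omega)^2\to[0,\infty]$ be the local discrepancy induced by $c$, $$D(\rho_0,\rho_1)=\int_\Omega c\left(\frac{\mathrm d\rho_0}{\mathrm d\rho},\frac{\mathrm d\rho_1}{\mathrm d\rho}\right)\mathrm d\rho ,$$ where $\rho$ is any finite nonnegative Radon measure with $\rho_0,\rho_1\ll\rho$,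 for instance $\rho=|\rho_0|+|\rho_1|$ (the value does not depend on this choice, and it is $\infty$ unless $\rho_0$ and $\rho_1$ are both nonnegative). Then $D$ is weakly-* lower semi-continuous on $\mathcal M(\Omega)^2$. In particular it is sequentially weakly-* lower semi-continuous: if $(\rho_0^n,\rho_1^n)_{n\in\mathbb N}$ converges weakly-* to $(\rho_0,\rho_1)$ in $\mathcal M(\Omega)^2$, then $D(\rho_0,\rho_1)\le\liminf_{n\to\infty}D(\rho_0^n,\rho_1^n)$. -/

import Mathlib

open MeasureTheory Filter Topology
open scoped ENNReal NNReal

/-- The integrands `c : ℝ × ℝ → [0, ∞]` that induce local discrepancies. Convexity is expressed over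
the semiring `ℝ≥0` (convex combinations have nonnegative coefficients) because `ℝ≥0∞` carries no
real scalar multiplication; in `ℝ≥0∞` the convention is `0 * ∞ = 0`. -/
structure IsDiscrepancyIntegrand (c : ℝ × ℝ → ℝ≥0∞) : Prop where
  convex : ConvexOn ℝ≥0 Set.univ c
  homogeneous : ∀ (t : ℝ), 0 < t → ∀ m : ℝ × ℝ, c (t • m) = ENNReal.ofReal t * c m
  lsc : LowerSemicontinuous c
  diag_eq_zero : ∀ m : ℝ, 0 ≤ m → c (m, m) = 0
  pos_of_ne : ∀ m₀ m₁ : ℝ, m₀ ≠ m₁ → 0 < c (m₀, m₁)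
  eq_top_of_neg : ∀ m₀ m₁ : ℝ, m₀ < 0 ∨ m₁ < 0 → c (m₀, m₁) = ∞

/-- `∫ c(dρ₀/dρ, dρ₁/dρ) dρ` for a given nonnegative reference measure `ρ`. -/
noncomputable def discrepancyIntegral {Ω : Type*} [MeasurableSpace Ω] (c : ℝ × ℝ → ℝ≥0∞)
    (ρ : Measure Ω) (ρ₀ ρ₁ : SignedMeasure Ω) : ℝ≥0∞ :=
  ∫⁻ x, c (ρ₀.rnDeriv ρ x, ρ₁.rnDeriv ρ x) ∂ρ

/-- The local discrepancy `D(ρ₀, ρ₁)` induced by `c`, with the reference measure `|ρ₀| + |ρ₁|`. Any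
other admissible reference measure gives the same value: `localDiscrepancy_eq`. -/
noncomputable def localDiscrepancy {Ω : Type*} [MeasurableSpace Ω] (c : ℝ × ℝ → ℝ≥0∞)
    (ρ₀ ρ₁ : SignedMeasure Ω) : ℝ≥0∞ :=
  discrepancyIntegral c (ρ₀.totalVariation + ρ₁.totalVariation) ρ₀ ρ₁

/-- The pairing `∫ u · dρ = ∫ u₀ dρ₀ + ∫ u₁ dρ₁` of `ρ = (ρ₀, ρ₁) ∈ M(Ω)²` with
`u = (u₀, u₁) ∈ C(Ω)²`. -/
noncomputable def measurePairing {Ω : Type*} [TopologicalSpace Ω] [MeasurableSpace Ω]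
    (ρ : SignedMeasure Ω × SignedMeasure Ω) (u : C(Ω, ℝ) × C(Ω, ℝ)) : ℝ :=
  (∫ᵛ x, u.1 x ∂<•ρ.1) + ∫ᵛ x, u.2 x ∂<•ρ.2

/-- The weak-* topology on `M(Ω)²`: the coarsest topology that makes all pairings with elements of
`C(Ω)²` continuous. -/
noncomputable instance weakStarTopology {Ω : Type*} [TopologicalSpace Ω] [MeasurableSpace Ω] :
    TopologicalSpace (SignedMeasure Ω × SignedMeasure Ω) :=
  TopologicalSpace.induced measurePairing inferInstance

/-- Change of reference measure for the Radon-Nikodym derivative of a signed measure. -/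
theorem signedMeasure_rnDeriv_chain {Ω : Type*} [MeasurableSpace Ω] (s : SignedMeasure Ω)
    (ν ρ : Measure Ω) [IsFiniteMeasure ν] [IsFiniteMeasure ρ] (hs : s.totalVariation ≪ ν)
    (hν : ν ≪ ρ) :
    s.rnDeriv ρ =ᵐ[ρ] fun x => (ν.rnDeriv ρ x).toReal • s.rnDeriv ν x := by
  have key : ∀ (τ : Measure Ω) [IsFiniteMeasure τ], s.totalVariation ≪ τ →
      τ.withDensityᵥ (s.rnDeriv τ) = s := by
    intro τ _ h
    refine SignedMeasure.withDensityᵥ_rnDeriv_eq s τ ?_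
    rw [SignedMeasure.absolutelyContinuous_ennreal_iff]
    have : τ.toENNRealVectorMeasure.ennrealToMeasure = τ :=
      VectorMeasure.equivMeasure.right_inv τ
    rwa [this]
  have hint : Integrable (s.rnDeriv ν) ν := SignedMeasure.integrable_rnDeriv _ _
  refine Integrable.ae_eq_of_withDensityᵥ_eq (SignedMeasure.integrable_rnDeriv _ _)
    ((integrable_rnDeriv_smul_iff hν).mpr hint) ?_
  rw [withDensityᵥ_rnDeriv_smul hν hint, key ν hs, key ρ (hs.trans hν)]

/-- The local discrepancy does not depend on the choice of the reference measure. -/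
theorem localDiscrepancy_eq {Ω : Type*} [MeasurableSpace Ω] {c : ℝ × ℝ → ℝ≥0∞}
    (hc : IsDiscrepancyIntegrand c) (ρ₀ ρ₁ : SignedMeasure Ω) (ρ : Measure Ω) [IsFiniteMeasure ρ]
    (h₀ : ρ₀.totalVariation ≪ ρ) (h₁ : ρ₁.totalVariation ≪ ρ) :
    localDiscrepancy c ρ₀ ρ₁ = discrepancyIntegral c ρ ρ₀ ρ₁ := by
  set ν : Measure Ω := ρ₀.totalVariation + ρ₁.totalVariation with hνdef
  have hν : ν ≪ ρ := by
    refine Measure.AbsolutelyContinuous.mk fun S _ hS => ?_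
    rw [hνdef, Measure.add_apply, h₀ hS, h₁ hS, add_zero]
  have h0 : ρ₀.totalVariation ≪ ν :=
    Measure.absolutelyContinuous_of_le (Measure.le_add_right le_rfl)
  have h1 : ρ₁.totalVariation ≪ ν :=
    Measure.absolutelyContinuous_of_le (Measure.le_add_left le_rfl)
  have hmeas : Measurable fun x => c (ρ₀.rnDeriv ν x, ρ₁.rnDeriv ν x) :=
    hc.lsc.measurable.comp
      ((SignedMeasure.measurable_rnDeriv _ _).prodMk (SignedMeasure.measurable_rnDeriv _ _))
  change ∫⁻ x, c (ρ₀.rnDeriv ν x, ρ₁.rnDeriv ν x) ∂ν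
    = ∫⁻ x, c (ρ₀.rnDeriv ρ x, ρ₁.rnDeriv ρ x) ∂ρ
  rw [← lintegral_rnDeriv_mul hν hmeas.aemeasurable]
  refine lintegral_congr_ae ?_
  filter_upwards [signedMeasure_rnDeriv_chain ρ₀ ν ρ h0 hν, signedMeasure_rnDeriv_chain ρ₁ ν ρ h1 hν,
    Measure.rnDeriv_lt_top ν ρ] with x e0 e1 hlt
  rw [e0, e1, ← Prod.smul_mk]
  rcases eq_or_ne (ν.rnDeriv ρ x) 0 with hz | hz
  · rw [hz, ENNReal.toReal_zero, zero_mul, zero_smul]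
    exact (hc.diag_eq_zero 0 le_rfl).symm
  · rw [hc.homogeneous _ (ENNReal.toReal_pos hz hlt.ne), ENNReal.ofReal_toReal hlt.ne]

/-- Outside of the nonnegative measures the local discrepancy is infinite. -/
theorem localDiscrepancy_eq_top {Ω : Type*} [MeasurableSpace Ω] {c : ℝ × ℝ → ℝ≥0∞}
    (hc : IsDiscrepancyIntegrand c) (ρ₀ ρ₁ : SignedMeasure Ω) (h : ¬ (0 ≤ ρ₀ ∧ 0 ≤ ρ₁)) :
    localDiscrepancy c ρ₀ ρ₁ = ∞ := by
  by_contra hfin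
  set ν : Measure Ω := ρ₀.totalVariation + ρ₁.totalVariation with hνdef
  have hmeas : Measurable fun x => c (ρ₀.rnDeriv ν x, ρ₁.rnDeriv ν x) :=
    hc.lsc.measurable.comp
      ((SignedMeasure.measurable_rnDeriv _ _).prodMk (SignedMeasure.measurable_rnDeriv _ _))
  have hae : ∀ᵐ x ∂ν, c (ρ₀.rnDeriv ν x, ρ₁.rnDeriv ν x) < ∞ := ae_lt_top hmeas hfin
  have key : ∀ s : SignedMeasure Ω, s.totalVariation ≪ ν → (∀ᵐ x ∂ν, 0 ≤ s.rnDeriv ν x) →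
      0 ≤ s := by
    intro s hs hpos
    have hd : ν.withDensityᵥ (s.rnDeriv ν) = s := by
      refine SignedMeasure.withDensityᵥ_rnDeriv_eq s ν ?_
      rw [SignedMeasure.absolutelyContinuous_ennreal_iff]
      have : ν.toENNRealVectorMeasure.ennrealToMeasure = ν :=
        VectorMeasure.equivMeasure.right_inv ν
      rwa [this]
    intro S hS
    rw [← hd, withDensityᵥ_apply (SignedMeasure.integrable_rnDeriv _ _) hS]
    exact integral_nonneg_of_ae (ae_restrict_of_ae hpos)
  refine h ⟨key ρ₀ (Measure.absolutelyContinuous_of_le (Measure.le_add_right le_rfl)) ?_,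
    key ρ₁ (Measure.absolutelyContinuous_of_le (Measure.le_add_left le_rfl)) ?_⟩
  · filter_upwards [hae] with x hx
    by_contra hneg
    exact hx.ne (hc.eq_top_of_neg _ _ (Or.inl (not_le.mp hneg)))
  · filter_upwards [hae] with x hx
    by_contra hneg
    exact hx.ne (hc.eq_top_of_neg _ _ (Or.inr (not_le.mp hneg)))

/-!
A lower semi-continuous, convex, positively 1-homogeneous `c : ℝ × ℝ → [0, ∞]` with `c 0 = 0` is the
supremum of the positive parts of its linear minorants `m ↦ a · m`, where `a` ranges over the closed
convex set `linearMinorants c ∋ 0`. This gives the dual formula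
`D(ρ) = sup {∫ u · dρ | u ∈ C(Ω)², u x ∈ linearMinorants c for all x}`,
which exhibits `D` as a supremum of weakly-* continuous functions.

The inequality `≥` in the dual formula is pointwise (`ofReal_measurePairing_le_localDiscrepancy`).
For `≤` (`exists_lt_ofReal_measurePairing`), write `c m = sup_n (a n · m)⁺` with countably many
minorants. Along the density `g = dρ/dν`, the maximum of `0` and the first `n` of the `a i · g x` is
attained by a measurable selection `w n x ∈ {0, a 0, …, a (n - 1)}` (`greedySelection`), and
`∫ w n · g dν` tends to `D(ρ)` by monotone convergence. Each `w n` is an almost everywhere limit of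
uniformly bounded continuous functions with values in `linearMinorants c`: it arises by finitely many
case distinctions along measurable sets, and those can be imitated by convex combinations with
continuous weights that converge a.e. to indicator functions (`IsBoundedLimit.piecewise`). Dominated
convergence then replaces `w n` by a continuous `u`.
-/

/-! ### Linear minorants of the integrand -/

/-- The vectors `a` whose linear functional `m ↦ a · m` lies below `c`, i.e. the subdifferential of
`c` at the origin. Since `c` takes values in `[0, ∞]`, only the positive part of `a · m` is compared. -/
def linearMinorants (c : ℝ × ℝ → ℝ≥0∞) : Set (ℝ × ℝ) :=
  {a | ∀ m : ℝ × ℝ, ENNReal.ofReal (a.1 * m.1 + a.2 * m.2) ≤ c m}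

theorem zero_mem_linearMinorants (c : ℝ × ℝ → ℝ≥0∞) : (0 : ℝ × ℝ) ∈ linearMinorants c := by
  intro m
  simp

theorem convex_linearMinorants (c : ℝ × ℝ → ℝ≥0∞) : Convex ℝ (linearMinorants c) := by
  intro a ha b hb s t hs ht hst m
  refine le_trans ?_ (max_le (ha m) (hb m))
  rw [← ENNReal.ofReal_max]
  apply ENNReal.ofReal_le_ofReal
  set p := a.1 * m.1 + a.2 * m.2
  set q := b.1 * m.1 + b.2 * m.2
  calc (s • a + t • b).1 * m.1 + (s • a + t • b).2 * m.2 = s * p + t * q := by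
        simp [p, q]; ring
    _ ≤ s * max p q + t * max p q := by gcongr <;> simp
    _ = max p q := by rw [← add_mul, hst, one_mul]

theorem IsDiscrepancyIntegrand.add_le {c : ℝ × ℝ → ℝ≥0∞} (hc : IsDiscrepancyIntegrand c)
    (x y : ℝ × ℝ) : c (x + y) ≤ c x + c y := by
  have h := hc.convex.2 (Set.mem_univ ((2 : ℝ) • x)) (Set.mem_univ ((2 : ℝ) • y))
    (zero_le (a := (2⁻¹ : ℝ≥0))) (zero_le (a := (2⁻¹ : ℝ≥0))) (by
      rw [← two_mul]; exact mul_inv_cancel₀ two_ne_zero)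
  have e : ∀ z : ℝ × ℝ, (2⁻¹ : ℝ≥0) • ((2 : ℝ) • z) = z := by
    intro z
    rw [NNReal.smul_def, smul_smul]; simp
  have e' : ∀ z : ℝ≥0∞, (2⁻¹ : ℝ≥0) • (2 * z) = z := by
    intro z
    rw [ENNReal.smul_def, smul_eq_mul, ← mul_assoc, ENNReal.coe_inv two_ne_zero, ENNReal.coe_ofNat,
      ENNReal.inv_mul_cancel two_ne_zero ENNReal.ofNat_ne_top, one_mul]
  rw [hc.homogeneous 2 two_pos, hc.homogeneous 2 two_pos, e, e, ENNReal.ofReal_ofNat, e', e'] at h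
  exact h

/-- The epigraph of `c` as a closed convex cone. The constraint `0 ≤ p.2` has to be added because
`ENNReal.ofReal` truncates negative heights to `0`. -/
def IsDiscrepancyIntegrand.epigraph {c : ℝ × ℝ → ℝ≥0∞} (hc : IsDiscrepancyIntegrand c) :
    ProperCone ℝ ((ℝ × ℝ) × ℝ) where
  carrier := {p | 0 ≤ p.2 ∧ c p.1 ≤ ENNReal.ofReal p.2}
  add_mem' := by
    rintro p q ⟨hp, hp'⟩ ⟨hq, hq'⟩
    refine ⟨add_nonneg hp hq, (hc.add_le _ _).trans ?_⟩
    rw [Prod.snd_add, ENNReal.ofReal_add hp hq]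
    exact add_le_add hp' hq'
  zero_mem' := ⟨le_rfl, by
    have h := hc.diag_eq_zero 0 le_rfl
    exact h.le.trans zero_le⟩
  smul_mem' := by
    rintro ⟨t, ht⟩ p ⟨hp, hp'⟩
    refine ⟨mul_nonneg ht hp, ?_⟩
    rcases ht.eq_or_lt with rfl | ht'
    · have h := hc.diag_eq_zero 0 le_rfl
      have : ((⟨0, ht⟩ : {r : ℝ // 0 ≤ r}) • p).1 = (0, 0) := by
        change (0 : ℝ) • p.1 = _
        rw [zero_smul]; rfl
      rw [this, h]
      exact zero_le
    · change c (t • p.1) ≤ ENNReal.ofReal (t * p.2)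
      rw [hc.homogeneous t ht', ENNReal.ofReal_mul ht]
      gcongr
  isClosed' := by
    have h : IsClosed {q : (ℝ × ℝ) × ℝ≥0∞ | c q.1 ≤ q.2} := hc.lsc.isClosed_epigraph
    exact (isClosed_le continuous_const continuous_snd).inter
      (h.preimage (continuous_fst.prodMk (ENNReal.continuous_ofReal.comp continuous_snd)))

/-- The Hahn-Banach step: `c` is the supremum of its linear minorants. A hyperplane through the
origin separates `(m, t)` from the epigraph; if it is not vertical, it is the graph of a minorant with value
greater than `t` at `m`. -/
theorem IsDiscrepancyIntegrand.exists_linearMinorant {c : ℝ × ℝ → ℝ≥0∞}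
    (hc : IsDiscrepancyIntegrand c) (m : ℝ × ℝ) {t : ℝ≥0∞} (ht : t < c m) :
    ∃ a ∈ linearMinorants c, t < ENNReal.ofReal (a.1 * m.1 + a.2 * m.2) := by
  lift t to ℝ≥0 using ht.ne_top
  have hnot : (m, (t : ℝ)) ∉ hc.epigraph := by
    rintro ⟨-, h⟩
    simp only [ENNReal.ofReal_coe_nnreal] at h
    exact absurd ht (not_lt.mpr h)
  obtain ⟨f, hf, hfm⟩ := ProperCone.hyperplane_separation_point _ hnot
  set a₁ := f ((1, 0), 0)
  set a₂ := f ((0, 1), 0)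
  set b := f ((0, 0), 1)
  have hfab : ∀ (x : ℝ × ℝ) (s : ℝ), f (x, s) = x.1 * a₁ + x.2 * a₂ + s * b := by
    intro x s
    have : (x, s) = x.1 • (((1, 0), 0) : (ℝ × ℝ) × ℝ) + x.2 • (((0, 1), 0) : (ℝ × ℝ) × ℝ)
        + s • (((0, 0), 1) : (ℝ × ℝ) × ℝ) := by
      ext <;> simp
    rw [this, map_add, map_add, map_smul, map_smul, map_smul]
    rfl
  have hfin : ∀ x : ℝ × ℝ, c x ≠ ∞ → 0 ≤ x.1 * a₁ + x.2 * a₂ + (c x).toReal * b := by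
    intro x hx
    rw [← hfab]
    exact hf _ ⟨ENNReal.toReal_nonneg, (ENNReal.ofReal_toReal hx).ge⟩
  have hb : 0 ≤ b := hf _ ⟨zero_le_one, (hc.diag_eq_zero 0 le_rfl).le.trans zero_le⟩
  rw [hfab] at hfm
  rcases hb.eq_or_lt with hb0 | hb0
  · -- A vertical hyperplane separates `m` from the domain of `c`. The functional with coefficients
    -- `-a₁`, `-a₂` is nonpositive on the domain and positive at `m`; as `0 ≤ c`, all its nonnegative
    -- multiples are minorants, with arbitrarily large values at `m`.
    rw [← hb0] at hfin hfm
    simp only [mul_zero, add_zero] at hfin hfm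
    set l := m.1 * a₁ + m.2 * a₂
    set r : ℝ := (t + 1) / (-l)
    have hr : 0 ≤ r := by
      have : 0 < -l := by linarith
      positivity
    refine ⟨(-r * a₁, -r * a₂), fun x => ?_, ?_⟩
    · rcases eq_or_ne (c x) ∞ with hx | hx
      · rw [hx]; exact le_top
      · rw [ENNReal.ofReal_of_nonpos]
        · exact zero_le
        · have := mul_nonneg hr (hfin x hx)
          dsimp only
          linarith
    · have : -r * a₁ * m.1 + -r * a₂ * m.2 = t + 1 := by
        have hl : l ≠ 0 := hfm.ne
        calc _ = -r * l := by simp only [l]; ring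
          _ = t + 1 := by simp only [r]; field_simp
      dsimp only
      rw [this, ENNReal.lt_ofReal_iff_toReal_lt ENNReal.coe_ne_top]
      simp
  · refine ⟨(-a₁ / b, -a₂ / b), fun x => ?_, ?_⟩
    · rcases eq_or_ne (c x) ∞ with hx | hx
      · rw [hx]; exact le_top
      · apply ENNReal.ofReal_le_of_le_toReal
        have := hfin x hx
        have e : -a₁ / b * x.1 + -a₂ / b * x.2 = -(x.1 * a₁ + x.2 * a₂) / b := by ring
        dsimp only
        rw [e, div_le_iff₀ hb0]
        linarith
    · have e : -a₁ / b * m.1 + -a₂ / b * m.2 = -(m.1 * a₁ + m.2 * a₂) / b := by ring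
      rw [ENNReal.lt_ofReal_iff_toReal_lt ENNReal.coe_ne_top, ENNReal.coe_toReal]
      dsimp only
      rw [e, lt_div_iff₀ hb0]
      linarith

/-- By separability of the plane, countably many linear minorants suffice. -/
theorem IsDiscrepancyIntegrand.exists_seq_iSup_eq {c : ℝ × ℝ → ℝ≥0∞}
    (hc : IsDiscrepancyIntegrand c) :
    ∃ a : ℕ → ℝ × ℝ, (∀ n, a n ∈ linearMinorants c) ∧
      ∀ m, c m = ⨆ n, ENNReal.ofReal ((a n).1 * m.1 + (a n).2 * m.2) := by
  have : Nonempty (linearMinorants c) := ⟨⟨0, zero_mem_linearMinorants c⟩⟩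
  let a := TopologicalSpace.denseSeq (linearMinorants c)
  refine ⟨fun n => a n, fun n => (a n).2, fun m => le_antisymm ?_ (iSup_le fun n => (a n).2 m)⟩
  refine le_of_forall_lt fun t ht => ?_
  obtain ⟨b, hb, hbt⟩ := hc.exists_linearMinorant m ht
  have hcont : Continuous fun b : linearMinorants c =>
      ENNReal.ofReal (b.1.1 * m.1 + b.1.2 * m.2) :=
    ENNReal.continuous_ofReal.comp (by fun_prop)
  obtain ⟨n, hn⟩ := (TopologicalSpace.denseRange_denseSeq (linearMinorants c)).exists_mem_open
    (isOpen_lt continuous_const hcont) ⟨⟨b, hb⟩, hbt⟩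
  exact hn.trans_le (le_iSup (fun n => ENNReal.ofReal ((a n).1.1 * m.1 + (a n).1.2 * m.2)) n)

/-! ### Approximation of measurable selections by continuous ones -/

theorem exists_continuous_tendsto_ae_indicator {Ω : Type*} [PseudoEMetricSpace Ω]
    [MeasurableSpace Ω] [BorelSpace Ω] (ν : Measure Ω) [IsFiniteMeasure ν] {A : Set Ω}
    (hA : MeasurableSet A) :
    ∃ φ : ℕ → C(Ω, ℝ), (∀ k x, φ k x ∈ Set.Icc (0 : ℝ) 1) ∧
      ∀ᵐ x ∂ν, Tendsto (fun k => φ k x) atTop (𝓝 (A.indicator (fun _ => 1) x)) := by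
  have hmem : MemLp (A.indicator fun _ => (1 : ℝ)) 1 ν :=
    memLp_indicator_const 1 hA 1 (Or.inr (measure_ne_top _ _))
  have happrox (k : ℕ) := hmem.exists_boundedContinuous_eLpNorm_sub_le ENNReal.one_ne_top
    (ε := ((k : ℝ≥0∞) + 1)⁻¹) (by simp [ENNReal.inv_eq_zero])
  choose g hg hgmem using happrox
  have hlim : TendstoInMeasure ν (fun k => (g k : Ω → ℝ)) atTop (A.indicator fun _ => 1) := by
    refine tendstoInMeasure_of_tendsto_eLpNorm one_ne_zero (fun k => (hgmem k).1) hmem.1 ?_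
    refine tendsto_of_tendsto_of_tendsto_of_le_of_le tendsto_const_nhds
      (h := fun k : ℕ => ((k : ℝ≥0∞) + 1)⁻¹) ?_ (fun _ => zero_le) fun k => ?_
    · have := (tendsto_add_atTop_iff_nat 1).2 ENNReal.tendsto_inv_nat_nhds_zero
      simpa using this
    · dsimp only
      rw [eLpNorm_sub_comm]
      exact hg k
  obtain ⟨ns, -, hns⟩ := hlim.exists_seq_tendsto_ae
  refine ⟨fun k => ⟨fun x => max 0 (min 1 (g (ns k) x)), by fun_prop⟩,
    fun k x => ⟨le_max_left _ _, max_le zero_le_one (min_le_left _ _)⟩, ?_⟩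
  filter_upwards [hns] with x hx
  have hclamp : Continuous fun t : ℝ => max 0 (min 1 t) := by fun_prop
  have := (hclamp.tendsto _).comp hx
  have e : max 0 (min 1 (A.indicator (fun _ => (1 : ℝ)) x)) = A.indicator (fun _ => 1) x := by
    by_cases hxA : x ∈ A <;> simp [hxA]
  rwa [e] at this

/-- `w` is the `ν`-almost everywhere limit of a uniformly bounded sequence of continuous functions
all of whose values lie in `K`. -/
def IsBoundedLimit {Ω E : Type*} [TopologicalSpace Ω] [MeasurableSpace Ω] [NormedAddCommGroup E]
    (ν : Measure Ω) (K : Set E) (w : Ω → E) : Prop :=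
  ∃ (C : ℝ) (u : ℕ → C(Ω, E)), (∀ k x, u k x ∈ K) ∧ (∀ k x, ‖u k x‖ ≤ C) ∧
    ∀ᵐ x ∂ν, Tendsto (fun k => u k x) atTop (𝓝 (w x))

theorem isBoundedLimit_const {Ω E : Type*} [TopologicalSpace Ω] [MeasurableSpace Ω]
    [NormedAddCommGroup E] (ν : Measure Ω) {K : Set E} {a : E} (ha : a ∈ K) :
    IsBoundedLimit ν K fun _ : Ω => a :=
  ⟨‖a‖, fun _ => ContinuousMap.const Ω a, fun _ _ => ha, fun _ _ => le_rfl,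
    Eventually.of_forall fun _ => tendsto_const_nhds⟩

open Classical in
/-- If `φ k` is continuous with values in `[0, 1]` and tends a.e. to the indicator of `A`, then
`φ k • p k + (1 - φ k) • q k` approximates the piecewise function and stays in the convex set `K`. -/
theorem IsBoundedLimit.piecewise {Ω E : Type*} [PseudoEMetricSpace Ω]
    [MeasurableSpace Ω] [BorelSpace Ω] [NormedAddCommGroup E] [NormedSpace ℝ E]
    {ν : Measure Ω} [IsFiniteMeasure ν] {K : Set E} (hK : Convex ℝ K) {v w : Ω → E}
    (hv : IsBoundedLimit ν K v) (hw : IsBoundedLimit ν K w) {A : Set Ω} (hA : MeasurableSet A) :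
    IsBoundedLimit ν K (A.piecewise v w) := by
  obtain ⟨C, p, hpK, hpC, hp⟩ := hv
  obtain ⟨C', q, hqK, hqC, hq⟩ := hw
  obtain ⟨φ, hφ, hlim⟩ := exists_continuous_tendsto_ae_indicator ν hA
  refine ⟨max C C', fun k => ⟨fun x => φ k x • p k x + (1 - φ k x) • q k x, by fun_prop⟩,
    fun k x => hK (hpK k x) (hqK k x) (hφ k x).1 (sub_nonneg.2 (hφ k x).2) (by ring),
    fun k x => ?_, ?_⟩
  · have hball := (convex_closedBall (0 : E) (max C C'))
      (mem_closedBall_zero_iff.2 ((hpC k x).trans (le_max_left _ _)))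
      (mem_closedBall_zero_iff.2 ((hqC k x).trans (le_max_right _ _)))
      (hφ k x).1 (sub_nonneg.2 (hφ k x).2) (by ring)
    exact mem_closedBall_zero_iff.1 hball
  · filter_upwards [hp, hq, hlim] with x hpx hqx hφx
    have := (hφx.smul hpx).add ((hφx.const_sub 1).smul hqx)
    have e : A.indicator (fun _ => (1 : ℝ)) x • v x + (1 - A.indicator (fun _ => (1 : ℝ)) x) • w x
        = A.piecewise v w x := by
      by_cases hxA : x ∈ A <;> simp [hxA]
    rwa [e] at this

/-! ### The pairing and the lower bound for the discrepancy -/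

theorem integral_signedMeasure_eq_integral_rnDeriv_mul {Ω : Type*} [MeasurableSpace Ω]
    (s : SignedMeasure Ω) (ν : Measure Ω) [IsFiniteMeasure ν] (hs : s.totalVariation ≪ ν)
    {f : Ω → ℝ} (hf : Integrable f s.totalVariation) :
    ∫ᵛ x, f x ∂<•s = ∫ x, s.rnDeriv ν x * f x ∂ν := by
  set j := s.toJordanDecomposition
  have hp : Integrable f j.posPart := hf.mono_measure (Measure.le_add_right le_rfl)
  have hn : Integrable f j.negPart := hf.mono_measure (Measure.le_add_left le_rfl)
  have hpν : j.posPart ≪ ν :=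
    (Measure.absolutelyContinuous_of_le (Measure.le_add_right le_rfl)).trans hs
  have hnν : j.negPart ≪ ν :=
    (Measure.absolutelyContinuous_of_le (Measure.le_add_left le_rfl)).trans hs
  have hj : s = j.posPart.toSignedMeasure - j.negPart.toSignedMeasure :=
    s.toSignedMeasure_toJordanDecomposition.symm
  calc ∫ᵛ x, f x ∂<•s
      = ∫ᵛ x, f x ∂<•(j.posPart.toSignedMeasure - j.negPart.toSignedMeasure) := by rw [← hj]
    _ = ∫ x, f x ∂j.posPart - ∫ x, f x ∂j.negPart := by
        rw [VectorMeasure.integral_sub_vectorMeasure, VectorMeasure.integral_toSignedMeasure,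
          VectorMeasure.integral_toSignedMeasure]
        · simpa [VectorMeasure.Integrable] using hp
        · simpa [VectorMeasure.Integrable] using hn
    _ = ∫ x, s.rnDeriv ν x * f x ∂ν := by
        rw [← integral_rnDeriv_smul hpν, ← integral_rnDeriv_smul hnν, ← integral_sub]
        · simp only [SignedMeasure.rnDeriv_def, smul_eq_mul, sub_mul]; rfl
        · exact (integrable_rnDeriv_smul_iff hpν).2 hp
        · exact (integrable_rnDeriv_smul_iff hnν).2 hn

theorem ofReal_integral_le_lintegral_ofReal {Ω : Type*} [MeasurableSpace Ω] {μ : Measure Ω}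
    {f : Ω → ℝ} (hf : Integrable f μ) :
    ENNReal.ofReal (∫ x, f x ∂μ) ≤ ∫⁻ x, ENNReal.ofReal (f x) ∂μ := by
  rw [integral_eq_lintegral_pos_part_sub_lintegral_neg_part hf]
  refine (ENNReal.ofReal_le_ofReal (sub_le_self _ ENNReal.toReal_nonneg)).trans ?_
  exact ENNReal.ofReal_toReal_le

theorem measurePairing_eq_integral {Ω : Type*} [TopologicalSpace Ω] [CompactSpace Ω]
    [MeasurableSpace Ω] [BorelSpace Ω] (ρ : SignedMeasure Ω × SignedMeasure Ω) (ν : Measure Ω)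
    [IsFiniteMeasure ν] (h₀ : ρ.1.totalVariation ≪ ν) (h₁ : ρ.2.totalVariation ≪ ν)
    (u : C(Ω, ℝ) × C(Ω, ℝ)) :
    Integrable (fun x => u.1 x * ρ.1.rnDeriv ν x + u.2 x * ρ.2.rnDeriv ν x) ν ∧
    measurePairing ρ u = ∫ x, (u.1 x * ρ.1.rnDeriv ν x + u.2 x * ρ.2.rnDeriv ν x) ∂ν := by
  have hint (f : C(Ω, ℝ)) (s : SignedMeasure Ω) : Integrable (fun x => f x * s.rnDeriv ν x) ν :=
    (s.integrable_rnDeriv ν).bdd_mul f.continuous.measurable.aestronglyMeasurable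
      (Eventually.of_forall f.norm_coe_le_norm)
  have hbdd (f : C(Ω, ℝ)) (τ : Measure Ω) [IsFiniteMeasure τ] : Integrable f τ :=
    Integrable.of_bound f.continuous.measurable.aestronglyMeasurable ‖f‖
      (Eventually.of_forall f.norm_coe_le_norm)
  refine ⟨(hint _ _).add (hint _ _), ?_⟩
  rw [measurePairing, integral_signedMeasure_eq_integral_rnDeriv_mul _ ν h₀ (hbdd _ _),
    integral_signedMeasure_eq_integral_rnDeriv_mul _ ν h₁ (hbdd _ _),
    integral_add (hint _ _) (hint _ _)]
  simp only [mul_comm]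

theorem totalVariation_fst_absolutelyContinuous {Ω : Type*} [MeasurableSpace Ω]
    (ρ₀ ρ₁ : SignedMeasure Ω) : ρ₀.totalVariation ≪ ρ₀.totalVariation + ρ₁.totalVariation :=
  Measure.absolutelyContinuous_of_le (Measure.le_add_right le_rfl)

theorem totalVariation_snd_absolutelyContinuous {Ω : Type*} [MeasurableSpace Ω]
    (ρ₀ ρ₁ : SignedMeasure Ω) : ρ₁.totalVariation ≪ ρ₀.totalVariation + ρ₁.totalVariation :=
  Measure.absolutelyContinuous_of_le (Measure.le_add_left le_rfl)

/-- The easy inequality of the dual formula. -/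
theorem ofReal_measurePairing_le_localDiscrepancy {Ω : Type*} [TopologicalSpace Ω] [CompactSpace Ω]
    [MeasurableSpace Ω] [BorelSpace Ω] {c : ℝ × ℝ → ℝ≥0∞}
    (ρ : SignedMeasure Ω × SignedMeasure Ω) {u : C(Ω, ℝ) × C(Ω, ℝ)}
    (hu : ∀ x, (u.1 x, u.2 x) ∈ linearMinorants c) :
    ENNReal.ofReal (measurePairing ρ u) ≤ localDiscrepancy c ρ.1 ρ.2 := by
  obtain ⟨hint, heq⟩ := measurePairing_eq_integral ρ _
    (totalVariation_fst_absolutelyContinuous ρ.1 ρ.2)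
    (totalVariation_snd_absolutelyContinuous ρ.1 ρ.2) u
  rw [heq]
  exact (ofReal_integral_le_lintegral_ofReal hint).trans (lintegral_mono fun x => hu x _)

/-! ### The dual formula and lower semi-continuity -/

open Classical in
/-- The `n`-th function selects, at each `x`, one of the vectors `0, a 0, …, a (n - 1)` that maximizes
the scalar product with `g x`; a later vector is chosen only if it is strictly better. -/
noncomputable def greedySelection {Ω : Type*} (a : ℕ → ℝ × ℝ) (g : Ω → ℝ × ℝ) : ℕ → Ω → ℝ × ℝ
  | 0 => fun _ => 0
  | n + 1 =>
    {x | (greedySelection a g n x).1 * (g x).1 + (greedySelection a g n x).2 * (g x).2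
      < (a n).1 * (g x).1 + (a n).2 * (g x).2}.piecewise (fun _ => a n) (greedySelection a g n)

theorem greedySelection_succ_apply {Ω : Type*} (a : ℕ → ℝ × ℝ) (g : Ω → ℝ × ℝ) (n : ℕ) (x : Ω) :
    (greedySelection a g (n + 1) x).1 * (g x).1 + (greedySelection a g (n + 1) x).2 * (g x).2 =
      max ((greedySelection a g n x).1 * (g x).1 + (greedySelection a g n x).2 * (g x).2)
        ((a n).1 * (g x).1 + (a n).2 * (g x).2) := by
  rw [greedySelection, Set.piecewise]
  split_ifs with h
  · exact (max_eq_right (le_of_lt h)).symm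
  · exact (max_eq_left (not_lt.1 h)).symm

theorem monotone_greedySelection {Ω : Type*} (a : ℕ → ℝ × ℝ) (g : Ω → ℝ × ℝ) (x : Ω) :
    Monotone fun n =>
      (greedySelection a g n x).1 * (g x).1 + (greedySelection a g n x).2 * (g x).2 :=
  monotone_nat_of_le_succ fun n => by
    rw [greedySelection_succ_apply]
    exact le_max_left _ _

theorem greedySelection_mem {Ω : Type*} {a : ℕ → ℝ × ℝ} {K : Set (ℝ × ℝ)} (h0 : 0 ∈ K)
    (ha : ∀ n, a n ∈ K) (g : Ω → ℝ × ℝ) (n : ℕ) (x : Ω) : greedySelection a g n x ∈ K := by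
  induction n with
  | zero => exact h0
  | succ n ih =>
    rw [greedySelection, Set.piecewise]
    split_ifs
    exacts [ha n, ih]

theorem measurable_greedySelection {Ω : Type*} [MeasurableSpace Ω] (a : ℕ → ℝ × ℝ)
    {g : Ω → ℝ × ℝ} (hg : Measurable g) (n : ℕ) : Measurable (greedySelection a g n) := by
  induction n with
  | zero => exact measurable_const
  | succ n ih =>
    exact Measurable.piecewise (measurableSet_lt (by fun_prop) (by fun_prop)) measurable_const ih

theorem isBoundedLimit_greedySelection {Ω : Type*} [PseudoEMetricSpace Ω] [MeasurableSpace Ω]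
    [BorelSpace Ω] (ν : Measure Ω) [IsFiniteMeasure ν] {a : ℕ → ℝ × ℝ} {K : Set (ℝ × ℝ)}
    (hK : Convex ℝ K) (h0 : 0 ∈ K) (ha : ∀ n, a n ∈ K) {g : Ω → ℝ × ℝ} (hg : Measurable g)
    (n : ℕ) : IsBoundedLimit ν K (greedySelection a g n) := by
  induction n with
  | zero => exact isBoundedLimit_const ν h0
  | succ n ih =>
    have hw := measurable_greedySelection a hg n
    exact (isBoundedLimit_const ν (ha n)).piecewise hK ih
      (measurableSet_lt (by fun_prop) (by fun_prop))

/-- Dominated convergence for scalar products with integrable functions `g₀` and `g₁`. -/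
theorem IsBoundedLimit.integrable_and_tendsto {Ω : Type*} [TopologicalSpace Ω]
    [MeasurableSpace Ω] [BorelSpace Ω] {ν : Measure Ω} {K : Set (ℝ × ℝ)} {w : Ω → ℝ × ℝ}
    (hw : IsBoundedLimit ν K w) (hwm : Measurable w) {g₀ g₁ : Ω → ℝ} (h₀ : Integrable g₀ ν)
    (h₁ : Integrable g₁ ν) :
    Integrable (fun x => (w x).1 * g₀ x + (w x).2 * g₁ x) ν ∧
    ∃ u : ℕ → C(Ω, ℝ × ℝ), (∀ k x, u k x ∈ K) ∧
      Tendsto (fun k => ∫ x, ((u k x).1 * g₀ x + (u k x).2 * g₁ x) ∂ν) atTop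
        (𝓝 (∫ x, ((w x).1 * g₀ x + (w x).2 * g₁ x) ∂ν)) := by
  obtain ⟨C, u, huK, huC, hlim⟩ := hw
  have hbound : ∀ (v : ℝ × ℝ) (x : Ω), ‖v‖ ≤ C →
      ‖v.1 * g₀ x + v.2 * g₁ x‖ ≤ C * (‖g₀ x‖ + ‖g₁ x‖) := by
    intro v x hv
    calc ‖v.1 * g₀ x + v.2 * g₁ x‖ ≤ ‖v.1‖ * ‖g₀ x‖ + ‖v.2‖ * ‖g₁ x‖ := by
          rw [← norm_mul, ← norm_mul]; exact norm_add_le _ _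
      _ ≤ C * ‖g₀ x‖ + C * ‖g₁ x‖ := by
          gcongr
          exacts [(norm_fst_le v).trans hv, (norm_snd_le v).trans hv]
      _ = C * (‖g₀ x‖ + ‖g₁ x‖) := (mul_add _ _ _).symm
  have hmeas : ∀ v : Ω → ℝ × ℝ, Measurable v →
      AEStronglyMeasurable (fun x => (v x).1 * g₀ x + (v x).2 * g₁ x) ν := fun v hv =>
    (hv.fst.aestronglyMeasurable.mul h₀.1).add (hv.snd.aestronglyMeasurable.mul h₁.1)
  have hdom : Integrable (fun x => C * (‖g₀ x‖ + ‖g₁ x‖)) ν := (h₀.norm.add h₁.norm).const_mul C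
  refine ⟨hdom.mono' (hmeas w hwm) ?_, u, huK, ?_⟩
  · filter_upwards [hlim] with x hx
    exact hbound _ _ (le_of_tendsto hx.norm (Eventually.of_forall fun k => huC k x))
  · refine tendsto_integral_of_dominated_convergence _
      (fun k => hmeas (u k) (u k).continuous.measurable) hdom
      (fun k => Eventually.of_forall fun x => hbound _ _ (huC k x)) ?_
    filter_upwards [hlim] with x hx
    exact ((((continuous_fst.tendsto _).comp hx).mul_const _).add
      (((continuous_snd.tendsto _).comp hx).mul_const _))

/-- The hard inequality of the dual formula: the pairings with continuous selections of
`linearMinorants c` come arbitrarily close to the discrepancy. -/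
theorem exists_lt_ofReal_measurePairing {Ω : Type*} [PseudoEMetricSpace Ω] [CompactSpace Ω]
    [MeasurableSpace Ω] [BorelSpace Ω] {c : ℝ × ℝ → ℝ≥0∞} (hc : IsDiscrepancyIntegrand c)
    (ρ : SignedMeasure Ω × SignedMeasure Ω) {t : ℝ≥0∞} (ht : t < localDiscrepancy c ρ.1 ρ.2) :
    ∃ u : C(Ω, ℝ) × C(Ω, ℝ), (∀ x, (u.1 x, u.2 x) ∈ linearMinorants c) ∧
      t < ENNReal.ofReal (measurePairing ρ u) := by
  rw [localDiscrepancy, discrepancyIntegral] at ht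
  set ν : Measure Ω := ρ.1.totalVariation + ρ.2.totalVariation
  set g : Ω → ℝ × ℝ := fun x => (ρ.1.rnDeriv ν x, ρ.2.rnDeriv ν x)
  have hg : Measurable g :=
    (SignedMeasure.measurable_rnDeriv _ _).prodMk (SignedMeasure.measurable_rnDeriv _ _)
  obtain ⟨a, ha, hsup⟩ := hc.exists_seq_iSup_eq
  set w := greedySelection a g
  have hwm := measurable_greedySelection a hg
  have hmono := monotone_greedySelection a g
  have hcg : ∀ x, c (g x) = ⨆ n, ENNReal.ofReal ((w n x).1 * (g x).1 + (w n x).2 * (g x).2) := by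
    intro x
    refine le_antisymm ?_
      (iSup_le fun n => greedySelection_mem (zero_mem_linearMinorants c) ha g n x (g x))
    rw [hsup]
    refine iSup_le fun n => le_iSup_of_le (n + 1) (ENNReal.ofReal_le_ofReal ?_)
    rw [greedySelection_succ_apply]
    exact le_max_right _ _
  change t < ∫⁻ x, c (g x) ∂ν at ht
  simp_rw [hcg] at ht
  rw [lintegral_iSup (fun n => by have := hwm n; fun_prop)
    (fun m n hmn x => ENNReal.ofReal_le_ofReal (hmono x hmn)), lt_iSup_iff] at ht
  obtain ⟨n, hn⟩ := ht
  obtain ⟨hint, u, huK, hlim⟩ := (isBoundedLimit_greedySelection ν (convex_linearMinorants c)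
    (zero_mem_linearMinorants c) ha hg n).integrable_and_tendsto (hwm n)
    (ρ.1.integrable_rnDeriv ν) (ρ.2.integrable_rnDeriv ν)
  -- The selections start with the vector `0`, so the scalar products are nonnegative.
  have hnonneg : ∀ x, 0 ≤ (w n x).1 * (g x).1 + (w n x).2 * (g x).2 := fun x => by
    simpa [greedySelection] using hmono x (Nat.zero_le n)
  rw [← ofReal_integral_eq_lintegral_ofReal hint (Eventually.of_forall hnonneg)] at hn
  obtain ⟨k, hk⟩ := (((ENNReal.continuous_ofReal.tendsto _).comp hlim).eventually
    (lt_mem_nhds hn)).exists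
  refine ⟨(⟨fun x => (u k x).1, by fun_prop⟩, ⟨fun x => (u k x).2, by fun_prop⟩), huK k, ?_⟩
  rw [(measurePairing_eq_integral ρ ν (totalVariation_fst_absolutelyContinuous ρ.1 ρ.2)
    (totalVariation_snd_absolutelyContinuous ρ.1 ρ.2) _).2]
  exact hk

theorem continuous_measurePairing {Ω : Type*} [TopologicalSpace Ω] [MeasurableSpace Ω]
    (u : C(Ω, ℝ) × C(Ω, ℝ)) :
    Continuous fun ρ : SignedMeasure Ω × SignedMeasure Ω => measurePairing ρ u := by
  have h : Continuous (measurePairing (Ω := Ω)) := continuous_induced_dom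
  exact (continuous_apply u).comp h

theorem proposition2p9 {Ω : Type*} [MetricSpace Ω] [CompactSpace Ω] [MeasurableSpace Ω]
    [BorelSpace Ω] (c : ℝ × ℝ → ℝ≥0∞) (hc : IsDiscrepancyIntegrand c) :
    LowerSemicontinuous
      (fun ρ : SignedMeasure Ω × SignedMeasure Ω => localDiscrepancy c ρ.1 ρ.2) ∧
    ∀ (r : ℕ → SignedMeasure Ω × SignedMeasure Ω) (ρ : SignedMeasure Ω × SignedMeasure Ω),
      Tendsto r atTop (𝓝 ρ) →
        localDiscrepancy c ρ.1 ρ.2 ≤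
          liminf (fun n => localDiscrepancy c (r n).1 (r n).2) atTop := by
  have hlsc : LowerSemicontinuous
      (fun ρ : SignedMeasure Ω × SignedMeasure Ω => localDiscrepancy c ρ.1 ρ.2) := by
    intro ρ t ht
    obtain ⟨u, hu, htu⟩ := exists_lt_ofReal_measurePairing hc ρ ht
    have hcont := ENNReal.continuous_ofReal.comp (continuous_measurePairing u)
    filter_upwards [(hcont.tendsto ρ).eventually (lt_mem_nhds htu)] with σ hσ
    exact hσ.trans_le (ofReal_measurePairing_le_localDiscrepancy σ hu)
  refine ⟨hlsc, fun r ρ hr => ?_⟩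
  exact (lowerSemicontinuousAt_iff_le_liminf.1 (hlsc ρ)).trans (liminf_le_liminf_of_le hr)
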